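/- Conventions. A Petri net $N$ consists of sets $S$ (places) and $T$ (transitions) and two functions $s,t:T\to\mathbb N[S]$ into the finite multisets over $S$ (the markings). Let $\mathcal C(N)$ be the free commutative strict monoidal category on $N$: its monoid of objects is $(\mathbb N[S],\oplus,0)$, and its morphisms are generated under composition and $\oplus$ by identities and one morphism $u:s(u)\to t(u)$ for each $u\in T$, modulo only the laws of a commutative strict monoidal category (a commutative monoid object in categories). Let $\chi$ be the function from the set of all morphisms of $\mathcal C(N)$ to $\mathbb N[T]$ that counts how many times each generator is used: $\chi(\mathrm{id})=0$, $\chi(u)=\{u\}$, $\chi(f;g)=\chi(f\oplus g)=\chi(f)+\chi(g)$. Let $\mathbf{Span}$ be the monoidal bicategory of sets, spans and maps of spans, with the cartesian product as tensor product. A lax-monoidal-lax functor $F:\mathcal C\to\mathbf{Span}$ from a commutative strict monoidal category (regarded as a locally discrete monoidal bicategory) is a lax functor together with a laxator $\mu_{A,B}:FA\times FB\to F(A\oplus B)$, with 2-cells $(Ff\times Fg);\mu_{A',B'}\Rightarrow\mu_{A,B};F(f\oplus g)$ making it a transformation, a unit $1\to F0$, and invertible associativity and left and right unit modifications subject to the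 usual two coherence laws. A Petri net with semantics in $\mathbf{Span}$ is a pair $(N,F)$ of a net and a lax-monoidal-lax functor $F:\mathcal C(N)\to\mathbf{Span}$; a morphism $(N,F)\to(M,G)$ is a strict monoidal functor $H:\mathcal C(N)\to\mathcal C(M)$ with $F=H;G$. These form a category $\mathbf{Petri}^{\mathbf{Span}}$. Proposition. For every Petri net $N$ there is a lax-monoidal-lax functor $N^\sharp:\mathcal C(N)\to\mathbf{Span}$, the external bound semantics of $N$, which - sends every object $A$ to the set of markings $\mathbb N[S]$; - sends every morphism $f:A\to B$ to the span $\mathbb N[S]\leftarrow\chi^{-1}(\chi(f))\to\mathbb N[S]$ whose apex is the set of all morphisms $h$ of $\mathcal C(N)$ (between any objects) with $\chi(h)=\chi(f)$, whose left leg sends $h$ to its target and whose right leg sends $h$ to its source; - has as comparison 2-cells for identities $M\mapsto \mathrm{id}_M$, and for composites $\chi^{-1}(\chi(f))\times_{\mathbb N[S]}\chi^{-1}(\chi(g))\to\chi^{-1}(\chi(f;g))$, $(h,k)\mapsto k;h$ (here the source of $h$ equals the target of $k$); - has as laxator the function $\oplus:\mathbb N[S]\times\mathbb N[S]\to\mathbb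 N[S]$, with 2-cells given on morphisms by $(h,k)\mapsto h\oplus k$, and as unit the empty marking. Moreover, the class of all pairs $(N,N^\sharp)$, for $N$ a Petri net, is the class of objects of a subcategory of $\mathbf{Petri}^{\mathbf{Span}}$, namely of the full one, whose morphisms are all morphisms of $\mathbf{Petri}^{\mathbf{Span}}$ between such pairs. -/

import Mathlib

open CategoryTheory
open scoped CategoryTheory.Bicategory

universe w v u

/-! ## The monoidal bicategory of sets, spans and maps of spans -/

/-- The objects of the bicategory of spans: sets. -/
structure SpanObj : Type (u + 1) where
  carrier : Type u

/-- A span of sets `X ← apex → Y`. -/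
structure SetSpan (X Y : SpanObj.{u}) : Type (u + 1) where
  apex : Type u
  left : apex → X.carrier
  right : apex → Y.carrier

/-- A map of spans: a function between the apexes that commutes with both legs. -/
@[ext]
structure SetSpan.Map {X Y : SpanObj.{u}} (f g : SetSpan X Y) : Type u where
  fn : f.apex → g.apex
  left_fn : ∀ x, g.left (fn x) = f.left x
  right_fn : ∀ x, g.right (fn x) = f.right x

namespace SetSpan

/-- The identity span. -/
def id (X : SpanObj.{u}) : SetSpan X X := ⟨X.carrier, fun x => x, fun x => x⟩

/-- The composite of two spans is given by the pullback of the inner legs. -/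
def comp {X Y Z : SpanObj.{u}} (f : SetSpan X Y) (g : SetSpan Y Z) : SetSpan X Z where
  apex := { p : f.apex × g.apex // f.right p.1 = g.left p.2 }
  left p := f.left p.1.1
  right p := g.right p.1.2

instance (X Y : SpanObj.{u}) : Category.{u} (SetSpan X Y) where
  Hom := SetSpan.Map
  id f := ⟨fun x => x, fun _ => rfl, fun _ => rfl⟩
  comp a b := ⟨fun x => b.fn (a.fn x), fun x => (b.left_fn _).trans (a.left_fn x),
    fun x => (b.right_fn _).trans (a.right_fn x)⟩

theorem hom_ext {X Y : SpanObj.{u}} {f g : SetSpan X Y} {a b : f ⟶ g}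
    (h : ∀ x, a.fn x = b.fn x) : a = b :=
  SetSpan.Map.ext (funext h)

/-- An invertible map of spans from a bijection of the apexes. -/
def mkIso {X Y : SpanObj.{u}} {f g : SetSpan X Y} (e : f.apex ≃ g.apex)
    (hl : ∀ x, g.left (e x) = f.left x) (hr : ∀ x, g.right (e x) = f.right x) : f ≅ g where
  hom := Map.mk e hl hr
  inv := Map.mk e.symm (fun x => by rw [← hl, e.apply_symm_apply])
    (fun x => by rw [← hr, e.apply_symm_apply])
  hom_inv_id := hom_ext fun x => e.symm_apply_apply x
  inv_hom_id := hom_ext fun x => e.apply_symm_apply x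

/-- Left whiskering of a map of spans. -/
def whiskerLeft {X Y Z : SpanObj.{u}} (f : SetSpan X Y) {g h : SetSpan Y Z} (η : g ⟶ h) :
    f.comp g ⟶ f.comp h :=
  Map.mk (fun p => ⟨(p.1.1, η.fn p.1.2), p.2.trans (η.left_fn _).symm⟩) (fun _ => rfl)
    (fun p => η.right_fn p.1.2)

/-- Right whiskering of a map of spans. -/
def whiskerRight {X Y Z : SpanObj.{u}} {f g : SetSpan X Y} (η : f ⟶ g) (h : SetSpan Y Z) :
    f.comp h ⟶ g.comp h :=
  Map.mk (fun p => ⟨(η.fn p.1.1, p.1.2), (η.right_fn _).trans p.2⟩) (fun p => η.left_fn p.1.1)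
    (fun _ => rfl)

/-- The associator for the composition of spans. -/
def associator {X Y Z W : SpanObj.{u}} (f : SetSpan X Y) (g : SetSpan Y Z) (h : SetSpan Z W) :
    (f.comp g).comp h ≅ f.comp (g.comp h) :=
  mkIso
    { toFun := fun p => ⟨(p.1.1.1.1, ⟨(p.1.1.1.2, p.1.2), p.2⟩), p.1.1.2⟩
      invFun := fun p => ⟨(⟨(p.1.1, p.1.2.1.1), p.2⟩, p.1.2.1.2), p.1.2.2⟩
      left_inv := fun _ => rfl
      right_inv := fun _ => rfl } (fun _ => rfl) (fun _ => rfl)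

/-- The left unitor for the composition of spans. -/
def leftUnitor {X Y : SpanObj.{u}} (f : SetSpan X Y) : (SetSpan.id X).comp f ≅ f :=
  mkIso
    { toFun := fun p => p.1.2
      invFun := fun x => ⟨(f.left x, x), rfl⟩
      left_inv := fun p => Subtype.ext (Prod.ext p.2.symm rfl)
      right_inv := fun _ => rfl } (fun p => p.2.symm) (fun _ => rfl)

/-- The right unitor for the composition of spans. -/
def rightUnitor {X Y : SpanObj.{u}} (f : SetSpan X Y) : f.comp (SetSpan.id Y) ≅ f :=
  mkIso
    { toFun := fun p => p.1.1
      invFun := fun x => ⟨(x, f.right x), rfl⟩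
      left_inv := fun p => Subtype.ext (Prod.ext rfl p.2)
      right_inv := fun _ => rfl } (fun _ => rfl) (fun p => p.2)

end SetSpan

/-- The bicategory of sets, spans and maps of spans. -/
instance : Bicategory.{u, u + 1} SpanObj.{u} where
  Hom := SetSpan
  id := SetSpan.id
  comp := SetSpan.comp
  homCategory X Y := inferInstanceAs (Category (SetSpan X Y))
  whiskerLeft := SetSpan.whiskerLeft
  whiskerRight := SetSpan.whiskerRight
  associator := SetSpan.associator
  leftUnitor := SetSpan.leftUnitor
  rightUnitor := SetSpan.rightUnitor
  whiskerLeft_id _ _ := rfl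
  whiskerLeft_comp _ _ _ _ _ _ := rfl
  id_whiskerLeft η := SetSpan.hom_ext fun p =>
    Subtype.ext (Prod.ext (p.2.trans (η.left_fn _).symm) rfl)
  comp_whiskerLeft _ _ _ _ _ := rfl
  id_whiskerRight _ _ := rfl
  comp_whiskerRight _ _ _ := rfl
  whiskerRight_id η := SetSpan.hom_ext fun p =>
    Subtype.ext (Prod.ext rfl (p.2.symm.trans (η.right_fn _).symm))
  whiskerRight_comp _ _ _ := rfl
  whisker_assoc _ _ _ _ _ := rfl
  whisker_exchange _ _ := rfl
  pentagon _ _ _ _ := rfl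
  triangle _ _ := SetSpan.hom_ext fun _ => rfl

namespace SetSpan

/-- A function, regarded as a span whose left leg is the identity. -/
def ofFun {X Y : SpanObj.{u}} (φ : X.carrier → Y.carrier) : X ⟶ Y :=
  SetSpan.mk X.carrier (fun x => x) φ

/-- The tensor product of objects is the cartesian product of sets. -/
def tensorObj (X Y : SpanObj.{u}) : SpanObj.{u} := ⟨X.carrier × Y.carrier⟩

infixr:90 " ⊠ " => SetSpan.tensorObj

/-- The unit object is the one-point set. -/
def unitObj : SpanObj.{u} := ⟨PUnit⟩

/-- The tensor product of spans. -/
def tensor {X Y X' Y' : SpanObj.{u}} (f : X ⟶ Y) (g : X' ⟶ Y') : X ⊠ X' ⟶ Y ⊠ Y' :=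
  SetSpan.mk (f.apex × g.apex) (fun p => (f.left p.1, g.left p.2))
    (fun p => (f.right p.1, g.right p.2))

infixr:90 " ⊠₁ " => SetSpan.tensor

/-- The tensor product of maps of spans. -/
def tensorMap {X Y X' Y' : SpanObj.{u}} {f g : X ⟶ Y} {f' g' : X' ⟶ Y'} (a : f ⟶ g)
    (b : f' ⟶ g') : f ⊠₁ f' ⟶ g ⊠₁ g' :=
  Map.mk (fun p => (a.fn p.1, b.fn p.2))
    (fun p => Prod.ext (a.left_fn p.1) (b.left_fn p.2))
    (fun p => Prod.ext (a.right_fn p.1) (b.right_fn p.2))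

infixr:90 " ⊠₂ " => SetSpan.tensorMap

/-- The tensor product of spans preserves composition. -/
def tensorComp {X Y Z X' Y' Z' : SpanObj.{u}} (f : X ⟶ Y) (g : Y ⟶ Z) (f' : X' ⟶ Y')
    (g' : Y' ⟶ Z') : (f ≫ g) ⊠₁ (f' ≫ g') ≅ (f ⊠₁ f') ≫ (g ⊠₁ g') :=
  mkIso
    { toFun := fun p => ⟨((p.1.1.1, p.2.1.1), (p.1.1.2, p.2.1.2)), Prod.ext p.1.2 p.2.2⟩
      invFun := fun p => (⟨(p.1.1.1, p.1.2.1), congrArg Prod.fst p.2⟩,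
        ⟨(p.1.1.2, p.1.2.2), congrArg Prod.snd p.2⟩)
      left_inv := fun _ => rfl
      right_inv := fun _ => rfl } (fun _ => rfl) (fun _ => rfl)

/-- The tensor product of spans preserves identities. -/
def tensorId (X Y : SpanObj.{u}) : 𝟙 X ⊠₁ 𝟙 Y ≅ 𝟙 (X ⊠ Y) :=
  mkIso (Equiv.refl _) (fun _ => rfl) (fun _ => rfl)

/-- The associator of the tensor product. -/
def assoc (X Y Z : SpanObj.{u}) : (X ⊠ Y) ⊠ Z ⟶ X ⊠ (Y ⊠ Z) :=
  ofFun fun p => (p.1.1, (p.1.2, p.2))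

/-- The left unitor of the tensor product. -/
def leftUnit (X : SpanObj.{u}) : unitObj ⊠ X ⟶ X := ofFun fun p => p.2

/-- The right unitor of the tensor product. -/
def rightUnit (X : SpanObj.{u}) : X ⊠ unitObj ⟶ X := ofFun fun p => p.1

/-- Pseudonaturality of the associator. -/
def assocNat {X Y Z X' Y' Z' : SpanObj.{u}} (f : X ⟶ X') (g : Y ⟶ Y') (h : Z ⟶ Z') :
    ((f ⊠₁ g) ⊠₁ h) ≫ assoc X' Y' Z' ≅ assoc X Y Z ≫ (f ⊠₁ (g ⊠₁ h)) :=
  mkIso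
    { toFun := fun p => ⟨(((f.left p.1.1.1.1, g.left p.1.1.1.2), h.left p.1.1.2),
        (p.1.1.1.1, (p.1.1.1.2, p.1.1.2))), rfl⟩
      invFun := fun p => ⟨(((p.1.2.1, p.1.2.2.1), p.1.2.2.2),
        ((f.right p.1.2.1, g.right p.1.2.2.1), h.right p.1.2.2.2)), rfl⟩
      left_inv := fun p => Subtype.ext (Prod.ext rfl p.2)
      right_inv := fun p => Subtype.ext (Prod.ext
        (Prod.ext (Prod.ext (congrArg (fun q => q.1) p.2.symm)
          (congrArg (fun q => q.2.1) p.2.symm)) (congrArg (fun q => q.2.2) p.2.symm)) rfl) }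
    (fun _ => rfl)
    (fun p => congrArg (assoc X' Y' Z').right p.2.symm |>.symm)

/-- Pseudonaturality of the left unitor. -/
def leftUnitNat {X Y : SpanObj.{u}} (f : X ⟶ Y) :
    (𝟙 unitObj ⊠₁ f) ≫ leftUnit Y ≅ leftUnit X ≫ f :=
  mkIso
    { toFun := fun p => ⟨((PUnit.unit, f.left p.1.1.2), p.1.1.2), rfl⟩
      invFun := fun p => ⟨((PUnit.unit, p.1.2), (PUnit.unit, f.right p.1.2)), rfl⟩
      left_inv := fun p => Subtype.ext (Prod.ext rfl p.2)
      right_inv := fun p => Subtype.ext (Prod.ext (Prod.ext rfl p.2.symm) rfl) }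
    (fun _ => rfl) (fun p => congrArg Prod.snd p.2)

/-- Pseudonaturality of the right unitor. -/
def rightUnitNat {X Y : SpanObj.{u}} (f : X ⟶ Y) :
    (f ⊠₁ 𝟙 unitObj) ≫ rightUnit Y ≅ rightUnit X ≫ f :=
  mkIso
    { toFun := fun p => ⟨((f.left p.1.1.1, PUnit.unit), p.1.1.1), rfl⟩
      invFun := fun p => ⟨((p.1.2, PUnit.unit), (f.right p.1.2, PUnit.unit)), rfl⟩
      left_inv := fun p => Subtype.ext (Prod.ext rfl p.2)
      right_inv := fun p => Subtype.ext (Prod.ext (Prod.ext p.2.symm rfl) rfl) }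
    (fun _ => rfl) (fun p => congrArg Prod.fst p.2)

/-- The pentagonator. -/
def pentagonator (W X Y Z : SpanObj.{u}) :
    (assoc W X Y ⊠₁ 𝟙 Z) ≫ assoc W (X ⊠ Y) Z ≫ (𝟙 W ⊠₁ assoc X Y Z) ≅
      assoc (W ⊠ X) Y Z ≫ assoc W X (Y ⊠ Z) :=
  mkIso
    { toFun := fun p => ⟨(p.1.1, ((p.1.1.1.1.1, p.1.1.1.1.2), (p.1.1.1.2, p.1.1.2))), rfl⟩
      invFun := fun p => ⟨(p.1.1, ⟨(((p.1.1.1.1.1, (p.1.1.1.1.2, p.1.1.1.2)), p.1.1.2),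
        (p.1.1.1.1.1, ((p.1.1.1.1.2, p.1.1.1.2), p.1.1.2))), rfl⟩), rfl⟩
      left_inv := fun p =>
        have h : ((p.1.1.1.1.1, (p.1.1.1.1.2, p.1.1.1.2)), p.1.1.2) = p.1.2.1.1 := p.2
        Subtype.ext (Prod.ext rfl (Subtype.ext (Prod.ext h
          ((congrArg (assoc W (X ⊠ Y) Z).right h).trans p.1.2.2))))
      right_inv := fun p => Subtype.ext (Prod.ext rfl p.2) }
    (fun _ => rfl)
    (fun p =>
      have h : ((p.1.1.1.1.1, (p.1.1.1.1.2, p.1.1.1.2)), p.1.1.2) = p.1.2.1.1 := p.2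
      congrArg (𝟙 W ⊠₁ assoc X Y Z).right
        ((congrArg (assoc W (X ⊠ Y) Z).right h).trans p.1.2.2))

/-- The invertible map of spans filling the triangle of associator and unitors. -/
def triangulator (X Y : SpanObj.{u}) :
    assoc X unitObj Y ≫ (𝟙 X ⊠₁ leftUnit Y) ≅ rightUnit X ⊠₁ 𝟙 Y :=
  mkIso
    { toFun := fun p => p.1.1
      invFun := fun p => ⟨(p, (p.1.1, (p.1.2, p.2))), rfl⟩
      left_inv := fun p => Subtype.ext (Prod.ext rfl p.2)
      right_inv := fun _ => rfl }
    (fun _ => rfl)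
    (fun p =>
      have h : (p.1.1.1.1, (p.1.1.1.2, p.1.1.2)) = p.1.2 := p.2
      congrArg (fun q : X.carrier × PUnit × Y.carrier => (q.1, q.2.2)) h)

/-! The following maps are pasted from the ones above. -/

/-- `- ⊠ Z` preserves composition. -/
def compRight {W X Y : SpanObj.{u}} (f : W ⟶ X) (g : X ⟶ Y) (Z : SpanObj.{u}) :
    (f ≫ g) ⊠₁ 𝟙 Z ⟶ (f ⊠₁ 𝟙 Z) ≫ (g ⊠₁ 𝟙 Z) :=
  (𝟙 (f ≫ g) ⊠₂ (λ_ (𝟙 Z)).inv) ≫ (tensorComp f g (𝟙 Z) (𝟙 Z)).hom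

/-- The inverse of `compRight`. -/
def compRightInv {W X Y : SpanObj.{u}} (f : W ⟶ X) (g : X ⟶ Y) (Z : SpanObj.{u}) :
    (f ⊠₁ 𝟙 Z) ≫ (g ⊠₁ 𝟙 Z) ⟶ (f ≫ g) ⊠₁ 𝟙 Z :=
  (tensorComp f g (𝟙 Z) (𝟙 Z)).inv ≫ (𝟙 (f ≫ g) ⊠₂ (λ_ (𝟙 Z)).hom)

/-- `Z ⊠ -` preserves composition. -/
def compLeft {W X Y : SpanObj.{u}} (Z : SpanObj.{u}) (f : W ⟶ X) (g : X ⟶ Y) :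
    𝟙 Z ⊠₁ (f ≫ g) ⟶ (𝟙 Z ⊠₁ f) ≫ (𝟙 Z ⊠₁ g) :=
  ((λ_ (𝟙 Z)).inv ⊠₂ 𝟙 (f ≫ g)) ≫ (tensorComp (𝟙 Z) (𝟙 Z) f g).hom

/-- The inverse of `compLeft`. -/
def compLeftInv {W X Y : SpanObj.{u}} (Z : SpanObj.{u}) (f : W ⟶ X) (g : X ⟶ Y) :
    (𝟙 Z ⊠₁ f) ≫ (𝟙 Z ⊠₁ g) ⟶ 𝟙 Z ⊠₁ (f ≫ g) :=
  (tensorComp (𝟙 Z) (𝟙 Z) f g).inv ≫ ((λ_ (𝟙 Z)).hom ⊠₂ 𝟙 (f ≫ g))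

/-- The identity square on a span. -/
def idSquare {X Y : SpanObj.{u}} (f : X ⟶ Y) : f ≫ 𝟙 Y ⟶ 𝟙 X ≫ f :=
  (ρ_ f).hom ≫ (λ_ f).inv

/-- The tensor product of two squares of spans, each filled by a map of spans. -/
def tensorSquare {X Y Z W X' Y' Z' W' : SpanObj.{u}}
    {p : X ⟶ Y} {m' : Y ⟶ W} {m : X ⟶ Z} {q : Z ⟶ W}
    {r : X' ⟶ Y'} {n' : Y' ⟶ W'} {n : X' ⟶ Z'} {s : Z' ⟶ W'}
    (a : p ≫ m' ⟶ m ≫ q) (b : r ≫ n' ⟶ n ≫ s) :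
    (p ⊠₁ r) ≫ (m' ⊠₁ n') ⟶ (m ⊠₁ n) ≫ (q ⊠₁ s) :=
  (tensorComp p m' r n').inv ≫ (a ⊠₂ b) ≫ (tensorComp m q n s).hom

/-- The interchange of `f ⊠ -` and `- ⊠ g`. -/
def exchange {X Y Z W : SpanObj.{u}} (f : X ⟶ Y) (g : Z ⟶ W) :
    (f ⊠₁ 𝟙 Z) ≫ (𝟙 Y ⊠₁ g) ⟶ (𝟙 X ⊠₁ g) ≫ (f ⊠₁ 𝟙 W) :=
  tensorSquare (idSquare f) ((λ_ g).hom ≫ (ρ_ g).inv)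

end SetSpan

/-! ## Commutative strict monoidal categories -/

/-- A commutative strict monoidal category, that is, a commutative monoid object in categories.
The monoidal product on objects is written `+`. -/
class CommStrictMonoidalCategory (C : Type u) [Category.{v} C] extends AddCommMonoid C where
  tensorHom : ∀ {A A' B B' : C}, (A ⟶ A') → (B ⟶ B') → (A + B ⟶ A' + B')
  tensorHom_id : ∀ A B : C, tensorHom (𝟙 A) (𝟙 B) = 𝟙 (A + B)
  tensorHom_comp : ∀ {A A' A'' B B' B'' : C} (f : A ⟶ A') (f' : A' ⟶ A'') (g : B ⟶ B')
    (g' : B' ⟶ B''), tensorHom (f ≫ f') (g ≫ g') = tensorHom f g ≫ tensorHom f' g'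
  tensorHom_assoc : ∀ {A A' B B' D D' : C} (f : A ⟶ A') (g : B ⟶ B') (h : D ⟶ D'),
    HEq (tensorHom (tensorHom f g) h) (tensorHom f (tensorHom g h))
  id_zero_tensorHom : ∀ {A A' : C} (f : A ⟶ A'), HEq (tensorHom (𝟙 0) f) f
  tensorHom_comm : ∀ {A A' B B' : C} (f : A ⟶ A') (g : B ⟶ B'),
    HEq (tensorHom f g) (tensorHom g f)

infixr:70 " ⊕ₘ " => CommStrictMonoidalCategory.tensorHom

theorem CategoryTheory.Functor.map_heq {C D : Type*} [Category* C] [Category* D] (F : C ⥤ D)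
    {A B A' B' : C} (hA : A = A') (hB : B = B') {f : A ⟶ B} {g : A' ⟶ B'} (h : HEq f g) :
    HEq (F.map f) (F.map g) := by
  subst hA hB
  cases h
  rfl

/-- A strict monoidal functor: a functor preserving the unit object and the monoidal product, on
objects and on morphisms, on the nose. -/
@[ext]
structure StrictMonoidalFunctor (C : Type u) [Category.{v} C] [CommStrictMonoidalCategory C]
    (D : Type u) [Category.{v} D] [CommStrictMonoidalCategory D] extends C ⥤ D where
  obj_zero : obj 0 = 0
  obj_add : ∀ A B : C, obj (A + B) = obj A + obj B
  map_tensorHom : ∀ {A A' B B' : C} (f : A ⟶ A') (g : B ⟶ B'),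
    HEq (map (f ⊕ₘ g)) (map f ⊕ₘ map g)

namespace StrictMonoidalFunctor

variable {C : Type u} [Category.{v} C] [CommStrictMonoidalCategory C]
  {D : Type u} [Category.{v} D] [CommStrictMonoidalCategory D]
  {E : Type u} [Category.{v} E] [CommStrictMonoidalCategory E]

variable (C) in
/-- The identity strict monoidal functor. -/
def id : StrictMonoidalFunctor C C where
  toFunctor := 𝟭 C
  obj_zero := rfl
  obj_add _ _ := rfl
  map_tensorHom _ _ := HEq.rfl

/-- The composite of two strict monoidal functors. -/
def comp (F : StrictMonoidalFunctor C D) (G : StrictMonoidalFunctor D E) :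
    StrictMonoidalFunctor C E where
  toFunctor := F.toFunctor ⋙ G.toFunctor
  obj_zero := (congrArg G.obj F.obj_zero).trans G.obj_zero
  obj_add A B := (congrArg G.obj (F.obj_add A B)).trans (G.obj_add _ _)
  map_tensorHom f g := (G.toFunctor.map_heq (F.obj_add _ _) (F.obj_add _ _)
    (F.map_tensorHom f g)).trans (G.map_tensorHom _ _)

end StrictMonoidalFunctor

/-! ## Lax-monoidal-lax functors to spans -/

open SetSpan in
/-- A lax-monoidal-lax functor from a (commutative) strict monoidal category `C`, regarded as a
locally discrete monoidal bicategory, to the monoidal bicategory of spans: a lax functor `F`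
with

* a laxator `F A ⊠ F B ⟶ F (A + B)` which is a transformation, with components for morphisms
  the maps of spans `laxatorNat`;
* a unit `1 ⟶ F 0`;
* invertible modifications `assocMod`, `leftMod`, `rightMod` relating laxator and unit to the
  associators and unitors, subject to the two coherence laws.

As `(A + B) + D` and `A + (B + D)` are equal objects, but not syntactically so, the laxator is
indexed by triples `A`, `B`, `D` with `A + B = D` and its components by triples of morphisms `f`,
`g`, `k` with `k = f ⊕ₘ g`; this is the same as giving it for `D := A + B`, `k := f ⊕ₘ g`. -/
structure LaxMonoidalLaxFunctor (C : Type u) [Category.{v} C] [CommStrictMonoidalCategory C]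
    extends LaxFunctor (LocallyDiscrete C) SpanObj.{w} where
  laxator : ∀ {A B D : C}, A + B = D → (obj ⟨A⟩ ⊠ obj ⟨B⟩ ⟶ obj ⟨D⟩)
  laxatorNat : ∀ {A B D A' B' D' : C} (h : A + B = D) (h' : A' + B' = D')
    (f : A ⟶ A') (g : B ⟶ B') (k : D ⟶ D'), HEq k (f ⊕ₘ g) →
    ((map f.toLoc ⊠₁ map g.toLoc) ≫ laxator h' ⟶ laxator h ≫ map k.toLoc)
  laxatorNat_id : ∀ {A B D : C} (h : A + B = D) (hk : HEq (𝟙 D) (𝟙 A ⊕ₘ 𝟙 B)),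
    ((tensorId (obj ⟨A⟩) (obj ⟨B⟩)).inv ≫ (mapId ⟨A⟩ ⊠₂ mapId ⟨B⟩)) ▷ laxator h ≫
        laxatorNat h h (𝟙 A) (𝟙 B) (𝟙 D) hk =
      (λ_ (laxator h)).hom ≫ (ρ_ (laxator h)).inv ≫ laxator h ◁ mapId ⟨D⟩
  laxatorNat_comp : ∀ {A B D A' B' D' A'' B'' D'' : C} (h : A + B = D) (h' : A' + B' = D')
    (h'' : A'' + B'' = D'') (f : A ⟶ A') (g : B ⟶ B') (k : D ⟶ D') (hk : HEq k (f ⊕ₘ g))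
    (f' : A' ⟶ A'') (g' : B' ⟶ B'') (k' : D' ⟶ D'') (hk' : HEq k' (f' ⊕ₘ g'))
    (hkk : HEq (k ≫ k') ((f ≫ f') ⊕ₘ (g ≫ g'))),
    ((tensorComp (map f.toLoc) (map f'.toLoc) (map g.toLoc) (map g'.toLoc)).inv ≫
          (mapComp f.toLoc f'.toLoc ⊠₂ mapComp g.toLoc g'.toLoc)) ▷ laxator h'' ≫
        laxatorNat h h'' (f ≫ f') (g ≫ g') (k ≫ k') hkk =
      (α_ _ _ _).hom ≫ (map f.toLoc ⊠₁ map g.toLoc) ◁ laxatorNat h' h'' f' g' k' hk' ≫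
        (α_ _ _ _).inv ≫ laxatorNat h h' f g k hk ▷ map k'.toLoc ≫ (α_ _ _ _).hom ≫
          laxator h ◁ mapComp k.toLoc k'.toLoc
  unit : unitObj ⟶ obj ⟨0⟩
  assocMod : ∀ {A₁ A₂ A₃ A₁₂ A₂₃ A₁₂₃ : C} (h₁₂ : A₁ + A₂ = A₁₂) (h₂₃ : A₂ + A₃ = A₂₃)
    (hl : A₁₂ + A₃ = A₁₂₃) (hr : A₁ + A₂₃ = A₁₂₃),
    (laxator h₁₂ ⊠₁ 𝟙 (obj ⟨A₃⟩)) ≫ laxator hl ≅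
      assoc (obj ⟨A₁⟩) (obj ⟨A₂⟩) (obj ⟨A₃⟩) ≫ (𝟙 (obj ⟨A₁⟩) ⊠₁ laxator h₂₃) ≫ laxator hr
  leftMod : ∀ A : C,
    (unit ⊠₁ 𝟙 (obj ⟨A⟩)) ≫ laxator (zero_add A) ≅ leftUnit (obj ⟨A⟩)
  rightMod : ∀ A : C,
    (𝟙 (obj ⟨A⟩) ⊠₁ unit) ≫ laxator (add_zero A) ≅ rightUnit (obj ⟨A⟩)
  /-- `assocMod` is a modification. -/
  assocMod_naturality : ∀ {A₁ A₂ A₃ A₁₂ A₂₃ A₁₂₃ B₁ B₂ B₃ B₁₂ B₂₃ B₁₂₃ : C}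
    (h₁₂ : A₁ + A₂ = A₁₂) (h₂₃ : A₂ + A₃ = A₂₃) (hl : A₁₂ + A₃ = A₁₂₃) (hr : A₁ + A₂₃ = A₁₂₃)
    (h₁₂' : B₁ + B₂ = B₁₂) (h₂₃' : B₂ + B₃ = B₂₃) (hl' : B₁₂ + B₃ = B₁₂₃)
    (hr' : B₁ + B₂₃ = B₁₂₃) (f₁ : A₁ ⟶ B₁) (f₂ : A₂ ⟶ B₂) (f₃ : A₃ ⟶ B₃) (f₁₂ : A₁₂ ⟶ B₁₂)
    (f₂₃ : A₂₃ ⟶ B₂₃) (f₁₂₃ : A₁₂₃ ⟶ B₁₂₃) (k₁₂ : HEq f₁₂ (f₁ ⊕ₘ f₂))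
    (k₂₃ : HEq f₂₃ (f₂ ⊕ₘ f₃)) (kl : HEq f₁₂₃ (f₁₂ ⊕ₘ f₃)) (kr : HEq f₁₂₃ (f₁ ⊕ₘ f₂₃)),
    𝟙 (((map f₁.toLoc ⊠₁ map f₂.toLoc) ⊠₁ map f₃.toLoc) ≫
        (laxator h₁₂' ⊠₁ 𝟙 (obj ⟨B₃⟩)) ≫ laxator hl') ⊗≫
      tensorSquare (laxatorNat h₁₂ h₁₂' f₁ f₂ f₁₂ k₁₂) (idSquare (map f₃.toLoc)) ▷
        laxator hl' ⊗≫
      (laxator h₁₂ ⊠₁ 𝟙 (obj ⟨A₃⟩)) ◁ laxatorNat hl hl' f₁₂ f₃ f₁₂₃ kl ⊗≫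
      (assocMod h₁₂ h₂₃ hl hr).hom ▷ map f₁₂₃.toLoc =
    ((map f₁.toLoc ⊠₁ map f₂.toLoc) ⊠₁ map f₃.toLoc) ◁ (assocMod h₁₂' h₂₃' hl' hr').hom ⊗≫
      (assocNat (map f₁.toLoc) (map f₂.toLoc) (map f₃.toLoc)).hom ▷
        ((𝟙 (obj ⟨B₁⟩) ⊠₁ laxator h₂₃') ≫ laxator hr') ⊗≫
      assoc (obj ⟨A₁⟩) (obj ⟨A₂⟩) (obj ⟨A₃⟩) ◁
        (tensorSquare (idSquare (map f₁.toLoc)) (laxatorNat h₂₃ h₂₃' f₂ f₃ f₂₃ k₂₃) ▷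
          laxator hr') ⊗≫
      (assoc (obj ⟨A₁⟩) (obj ⟨A₂⟩) (obj ⟨A₃⟩) ≫ (𝟙 (obj ⟨A₁⟩) ⊠₁ laxator h₂₃)) ◁
        laxatorNat hr hr' f₁ f₂₃ f₁₂₃ kr ⊗≫
      𝟙 ((assoc (obj ⟨A₁⟩) (obj ⟨A₂⟩) (obj ⟨A₃⟩) ≫ (𝟙 (obj ⟨A₁⟩) ⊠₁ laxator h₂₃) ≫
        laxator hr) ≫ map f₁₂₃.toLoc)
  /-- `leftMod` is a modification. -/
  leftMod_naturality : ∀ {A B : C} (f : A ⟶ B) (hk : HEq f (𝟙 (0 : C) ⊕ₘ f)),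
    𝟙 ((𝟙 unitObj ⊠₁ map f.toLoc) ≫ (unit ⊠₁ 𝟙 (obj ⟨B⟩)) ≫ laxator (zero_add B)) ⊗≫
      tensorSquare (q := map (𝟙 (0 : C)).toLoc) ((λ_ unit).hom ≫ (ρ_ unit).inv ≫ unit ◁ mapId ⟨0⟩)
        (idSquare (map f.toLoc)) ▷ laxator (zero_add B) ⊗≫
      (unit ⊠₁ 𝟙 (obj ⟨A⟩)) ◁ laxatorNat (zero_add A) (zero_add B) (𝟙 0) f f hk ⊗≫
      (leftMod A).hom ▷ map f.toLoc =
    (𝟙 unitObj ⊠₁ map f.toLoc) ◁ (leftMod B).hom ≫ (leftUnitNat (map f.toLoc)).hom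
  /-- `rightMod` is a modification. -/
  rightMod_naturality : ∀ {A B : C} (f : A ⟶ B) (hk : HEq f (f ⊕ₘ 𝟙 (0 : C))),
    𝟙 ((map f.toLoc ⊠₁ 𝟙 unitObj) ≫ (𝟙 (obj ⟨B⟩) ⊠₁ unit) ≫ laxator (add_zero B)) ⊗≫
      tensorSquare (s := map (𝟙 (0 : C)).toLoc) (idSquare (map f.toLoc))
        ((λ_ unit).hom ≫ (ρ_ unit).inv ≫ unit ◁ mapId ⟨0⟩) ▷ laxator (add_zero B) ⊗≫
      (𝟙 (obj ⟨A⟩) ⊠₁ unit) ◁ laxatorNat (add_zero A) (add_zero B) f (𝟙 0) f hk ⊗≫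
      (rightMod A).hom ▷ map f.toLoc =
    (map f.toLoc ⊠₁ 𝟙 unitObj) ◁ (rightMod B).hom ≫ (rightUnitNat (map f.toLoc)).hom
  /-- The coherence law for fourfold products. -/
  assocMod_coherence : ∀ {A₁ A₂ A₃ A₄ A₁₂ A₂₃ A₃₄ A₁₂₃ A₂₃₄ A₁₂₃₄ : C}
    (h₁₂ : A₁ + A₂ = A₁₂) (h₂₃ : A₂ + A₃ = A₂₃) (h₃₄ : A₃ + A₄ = A₃₄)
    (l₁₂₃ : A₁₂ + A₃ = A₁₂₃) (r₁₂₃ : A₁ + A₂₃ = A₁₂₃)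
    (l₂₃₄ : A₂₃ + A₄ = A₂₃₄) (r₂₃₄ : A₂ + A₃₄ = A₂₃₄)
    (l : A₁₂₃ + A₄ = A₁₂₃₄) (m : A₁₂ + A₃₄ = A₁₂₃₄) (r : A₁ + A₂₃₄ = A₁₂₃₄),
    𝟙 (((laxator h₁₂ ⊠₁ 𝟙 (obj ⟨A₃⟩)) ⊠₁ 𝟙 (obj ⟨A₄⟩)) ≫
        (laxator l₁₂₃ ⊠₁ 𝟙 (obj ⟨A₄⟩)) ≫ laxator l) ⊗≫
      (compRightInv (laxator h₁₂ ⊠₁ 𝟙 (obj ⟨A₃⟩)) (laxator l₁₂₃) (obj ⟨A₄⟩) ≫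
        ((assocMod h₁₂ h₂₃ l₁₂₃ r₁₂₃).hom ⊠₂ 𝟙 (𝟙 (obj ⟨A₄⟩))) ≫
        compRight (assoc (obj ⟨A₁⟩) (obj ⟨A₂⟩) (obj ⟨A₃⟩))
          ((𝟙 (obj ⟨A₁⟩) ⊠₁ laxator h₂₃) ≫ laxator r₁₂₃) (obj ⟨A₄⟩) ≫
        (assoc (obj ⟨A₁⟩) (obj ⟨A₂⟩) (obj ⟨A₃⟩) ⊠₁ 𝟙 (obj ⟨A₄⟩)) ◁
          compRight (𝟙 (obj ⟨A₁⟩) ⊠₁ laxator h₂₃) (laxator r₁₂₃) (obj ⟨A₄⟩)) ▷ laxator l ⊗≫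
      ((assoc (obj ⟨A₁⟩) (obj ⟨A₂⟩) (obj ⟨A₃⟩) ⊠₁ 𝟙 (obj ⟨A₄⟩)) ≫
        ((𝟙 (obj ⟨A₁⟩) ⊠₁ laxator h₂₃) ⊠₁ 𝟙 (obj ⟨A₄⟩))) ◁ (assocMod r₁₂₃ l₂₃₄ l r).hom ⊗≫
      (assoc (obj ⟨A₁⟩) (obj ⟨A₂⟩) (obj ⟨A₃⟩) ⊠₁ 𝟙 (obj ⟨A₄⟩)) ◁
        ((assocNat (𝟙 (obj ⟨A₁⟩)) (laxator h₂₃) (𝟙 (obj ⟨A₄⟩))).hom ▷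
          ((𝟙 (obj ⟨A₁⟩) ⊠₁ laxator l₂₃₄) ≫ laxator r)) ⊗≫
      ((assoc (obj ⟨A₁⟩) (obj ⟨A₂⟩) (obj ⟨A₃⟩) ⊠₁ 𝟙 (obj ⟨A₄⟩)) ≫
          assoc (obj ⟨A₁⟩) (obj ⟨A₂⟩ ⊠ obj ⟨A₃⟩) (obj ⟨A₄⟩)) ◁
        ((compLeftInv (obj ⟨A₁⟩) (laxator h₂₃ ⊠₁ 𝟙 (obj ⟨A₄⟩)) (laxator l₂₃₄) ≫
          (𝟙 (𝟙 (obj ⟨A₁⟩)) ⊠₂ (assocMod h₂₃ h₃₄ l₂₃₄ r₂₃₄).hom) ≫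
          compLeft (obj ⟨A₁⟩) (assoc (obj ⟨A₂⟩) (obj ⟨A₃⟩) (obj ⟨A₄⟩))
            ((𝟙 (obj ⟨A₂⟩) ⊠₁ laxator h₃₄) ≫ laxator r₂₃₄) ≫
          (𝟙 (obj ⟨A₁⟩) ⊠₁ assoc (obj ⟨A₂⟩) (obj ⟨A₃⟩) (obj ⟨A₄⟩)) ◁
            compLeft (obj ⟨A₁⟩) (𝟙 (obj ⟨A₂⟩) ⊠₁ laxator h₃₄) (laxator r₂₃₄)) ▷
          laxator r) ⊗≫
      (pentagonator (obj ⟨A₁⟩) (obj ⟨A₂⟩) (obj ⟨A₃⟩) (obj ⟨A₄⟩)).hom ▷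
        ((𝟙 (obj ⟨A₁⟩) ⊠₁ (𝟙 (obj ⟨A₂⟩) ⊠₁ laxator h₃₄)) ≫
          (𝟙 (obj ⟨A₁⟩) ⊠₁ laxator r₂₃₄) ≫ laxator r) =
    ((laxator h₁₂ ⊠₁ 𝟙 (obj ⟨A₃⟩)) ⊠₁ 𝟙 (obj ⟨A₄⟩)) ◁ (assocMod l₁₂₃ h₃₄ l m).hom ⊗≫
      ((assocNat (laxator h₁₂) (𝟙 (obj ⟨A₃⟩)) (𝟙 (obj ⟨A₄⟩))).hom ≫
        assoc (obj ⟨A₁⟩ ⊠ obj ⟨A₂⟩) (obj ⟨A₃⟩) (obj ⟨A₄⟩) ◁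
          (𝟙 (laxator h₁₂) ⊠₂ (tensorId (obj ⟨A₃⟩) (obj ⟨A₄⟩)).hom)) ▷
        ((𝟙 (obj ⟨A₁₂⟩) ⊠₁ laxator h₃₄) ≫ laxator m) ⊗≫
      assoc (obj ⟨A₁⟩ ⊠ obj ⟨A₂⟩) (obj ⟨A₃⟩) (obj ⟨A₄⟩) ◁
        (exchange (laxator h₁₂) (laxator h₃₄) ▷ laxator m) ⊗≫
      (assoc (obj ⟨A₁⟩ ⊠ obj ⟨A₂⟩) (obj ⟨A₃⟩) (obj ⟨A₄⟩) ≫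
          (𝟙 (obj ⟨A₁⟩ ⊠ obj ⟨A₂⟩) ⊠₁ laxator h₃₄)) ◁ (assocMod h₁₂ r₂₃₄ m r).hom ⊗≫
      assoc (obj ⟨A₁⟩ ⊠ obj ⟨A₂⟩) (obj ⟨A₃⟩) (obj ⟨A₄⟩) ◁
        ((((tensorId (obj ⟨A₁⟩) (obj ⟨A₂⟩)).inv ⊠₂ 𝟙 (laxator h₃₄)) ▷
            assoc (obj ⟨A₁⟩) (obj ⟨A₂⟩) (obj ⟨A₃₄⟩) ≫
          (assocNat (𝟙 (obj ⟨A₁⟩)) (𝟙 (obj ⟨A₂⟩)) (laxator h₃₄)).hom) ▷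
          ((𝟙 (obj ⟨A₁⟩) ⊠₁ laxator r₂₃₄) ≫ laxator r)) ⊗≫
      𝟙 ((assoc (obj ⟨A₁⟩ ⊠ obj ⟨A₂⟩) (obj ⟨A₃⟩) (obj ⟨A₄⟩) ≫
          assoc (obj ⟨A₁⟩) (obj ⟨A₂⟩) (obj ⟨A₃⟩ ⊠ obj ⟨A₄⟩)) ≫
        (𝟙 (obj ⟨A₁⟩) ⊠₁ (𝟙 (obj ⟨A₂⟩) ⊠₁ laxator h₃₄)) ≫
          (𝟙 (obj ⟨A₁⟩) ⊠₁ laxator r₂₃₄) ≫ laxator r)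
  /-- The coherence law for products with the unit in the middle. -/
  unit_coherence : ∀ {A B D : C} (h : A + B = D),
    𝟙 (((𝟙 (obj ⟨A⟩) ⊠₁ unit) ⊠₁ 𝟙 (obj ⟨B⟩)) ≫
        (laxator (add_zero A) ⊠₁ 𝟙 (obj ⟨B⟩)) ≫ laxator h) ⊗≫
      (compRightInv (𝟙 (obj ⟨A⟩) ⊠₁ unit) (laxator (add_zero A)) (obj ⟨B⟩) ≫
        ((rightMod A).hom ⊠₂ 𝟙 (𝟙 (obj ⟨B⟩)))) ▷ laxator h =
    ((𝟙 (obj ⟨A⟩) ⊠₁ unit) ⊠₁ 𝟙 (obj ⟨B⟩)) ◁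
        (assocMod (add_zero A) (zero_add B) h h).hom ⊗≫
      (assocNat (𝟙 (obj ⟨A⟩)) unit (𝟙 (obj ⟨B⟩))).hom ▷
        ((𝟙 (obj ⟨A⟩) ⊠₁ laxator (zero_add B)) ≫ laxator h) ⊗≫
      assoc (obj ⟨A⟩) unitObj (obj ⟨B⟩) ◁
        ((compLeftInv (obj ⟨A⟩) (unit ⊠₁ 𝟙 (obj ⟨B⟩)) (laxator (zero_add B)) ≫
          (𝟙 (𝟙 (obj ⟨A⟩)) ⊠₂ (leftMod B).hom)) ▷ laxator h) ⊗≫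
      (triangulator (obj ⟨A⟩) (obj ⟨B⟩)).hom ▷ laxator h

/-- `K = F ⋙ L` as lax-monoidal-lax functors, for a strict monoidal functor `F`: the two sides have
equal values on objects and on morphisms, and equal structure. -/
structure TriangleCommutes {C : Type u} [Category.{v} C] [CommStrictMonoidalCategory C]
    {D : Type u} [Category.{v} D] [CommStrictMonoidalCategory D]
    (K : LaxMonoidalLaxFunctor.{w} C) (F : StrictMonoidalFunctor C D)
    (L : LaxMonoidalLaxFunctor.{w} D) : Prop where
  obj : ∀ A : C, K.obj ⟨A⟩ = L.obj ⟨F.obj A⟩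
  map : ∀ {A B : C} (f : A ⟶ B), HEq (K.map f.toLoc) (L.map (F.map f).toLoc)
  mapId : ∀ A : C, HEq (K.mapId ⟨A⟩) (L.mapId ⟨F.obj A⟩)
  mapComp : ∀ {A B D : C} (f : A ⟶ B) (g : B ⟶ D),
    HEq (K.mapComp f.toLoc g.toLoc) (L.mapComp (F.map f).toLoc (F.map g).toLoc)
  laxator : ∀ {A B D : C} (h : A + B = D) (h' : F.obj A + F.obj B = F.obj D),
    HEq (K.laxator h) (L.laxator h')
  laxatorNat : ∀ {A B D A' B' D' : C} (h : A + B = D) (h' : A' + B' = D')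
    (f : A ⟶ A') (g : B ⟶ B') (k : D ⟶ D') (hk : HEq k (f ⊕ₘ g))
    (i : F.obj A + F.obj B = F.obj D) (i' : F.obj A' + F.obj B' = F.obj D')
    (ik : HEq (F.map k) (F.map f ⊕ₘ F.map g)),
    HEq (K.laxatorNat h h' f g k hk) (L.laxatorNat i i' (F.map f) (F.map g) (F.map k) ik)
  unit : HEq K.unit L.unit
  assocMod : ∀ {A₁ A₂ A₃ A₁₂ A₂₃ A₁₂₃ : C} (h₁₂ : A₁ + A₂ = A₁₂) (h₂₃ : A₂ + A₃ = A₂₃)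
    (hl : A₁₂ + A₃ = A₁₂₃) (hr : A₁ + A₂₃ = A₁₂₃)
    (i₁₂ : F.obj A₁ + F.obj A₂ = F.obj A₁₂) (i₂₃ : F.obj A₂ + F.obj A₃ = F.obj A₂₃)
    (il : F.obj A₁₂ + F.obj A₃ = F.obj A₁₂₃) (ir : F.obj A₁ + F.obj A₂₃ = F.obj A₁₂₃),
    HEq (K.assocMod h₁₂ h₂₃ hl hr) (L.assocMod i₁₂ i₂₃ il ir)
  leftMod : ∀ A : C, HEq (K.leftMod A) (L.leftMod (F.obj A))
  rightMod : ∀ A : C, HEq (K.rightMod A) (L.rightMod (F.obj A))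

/-! ## Petri nets and their categories of executions -/

/-- A Petri net: a pair of functions from transitions to multisets of places. -/
structure PetriNet : Type (u + 1) where
  Place : Type u
  Transition : Type u
  source : Transition → Multiset Place
  target : Transition → Multiset Place

namespace PetriNet

/-- Formal compositions and monoidal products of transitions and identities. -/
inductive Term (N : PetriNet.{u}) : Multiset N.Place → Multiset N.Place → Type u
  | id (A : Multiset N.Place) : Term N A A
  | gen (t : N.Transition) : Term N (N.source t) (N.target t)
  | comp {A B C : Multiset N.Place} (f : Term N A B) (g : Term N B C) : Term N A C
  | tensor {A B A' B' : Multiset N.Place} (f : Term N A B) (g : Term N A' B') :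
      Term N (A + A') (B + B')

namespace Term

/-- The congruence generated by the laws of a commutative strict monoidal category. Related terms
have equal domains and equal codomains, see `PetriNet.Term.Rel.dom_eq` and
`PetriNet.Term.Rel.cod_eq`. -/
inductive Rel {N : PetriNet.{u}} :
    ∀ {A B A' B' : Multiset N.Place}, Term N A B → Term N A' B' → Prop
  | refl {A B} (f : Term N A B) : Rel f f
  | symm {A B A' B'} {f : Term N A B} {g : Term N A' B'} : Rel f g → Rel g f
  | trans {A B A' B' A'' B''} {f : Term N A B} {g : Term N A' B'} {h : Term N A'' B''} :
      Rel f g → Rel g h → Rel f h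
  | comp_congr {A B C A' B' C'} {f : Term N A B} {g : Term N B C} {f' : Term N A' B'}
      {g' : Term N B' C'} : Rel f f' → Rel g g' → Rel (f.comp g) (f'.comp g')
  | tensor_congr {A B C D A' B' C' D'} {f : Term N A B} {g : Term N C D} {f' : Term N A' B'}
      {g' : Term N C' D'} : Rel f f' → Rel g g' → Rel (f.tensor g) (f'.tensor g')
  | id_comp {A B} (f : Term N A B) : Rel ((id A).comp f) f
  | comp_id {A B} (f : Term N A B) : Rel (f.comp (id B)) f
  | assoc {A B C D} (f : Term N A B) (g : Term N B C) (h : Term N C D) :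
      Rel ((f.comp g).comp h) (f.comp (g.comp h))
  | tensor_id (A B) : Rel ((id A).tensor (id B)) (id (A + B))
  | interchange {A B C A' B' C'} (f : Term N A B) (g : Term N B C) (f' : Term N A' B')
      (g' : Term N B' C') :
      Rel ((f.comp g).tensor (f'.comp g')) ((f.tensor f').comp (g.tensor g'))
  | tensor_assoc {A B A' B' A'' B''} (f : Term N A B) (g : Term N A' B') (h : Term N A'' B'') :
      Rel ((f.tensor g).tensor h) (f.tensor (g.tensor h))
  | id_zero_tensor {A B} (f : Term N A B) : Rel ((id 0).tensor f) f
  | tensor_comm {A B A' B'} (f : Term N A B) (g : Term N A' B') :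
      Rel (f.tensor g) (g.tensor f)

theorem Rel.dom_eq {N : PetriNet.{u}} {A B A' B' : Multiset N.Place} {f : Term N A B}
    {g : Term N A' B'} (h : Rel f g) : A = A' := by
  induction h with
  | refl | comp_congr | id_comp | comp_id | assoc | tensor_id | interchange => first | rfl | assumption
  | symm _ ih => exact ih.symm
  | trans _ _ ih ih' => exact ih.trans ih'
  | tensor_congr _ _ ih ih' => rw [ih, ih']
  | tensor_assoc => exact add_assoc _ _ _
  | id_zero_tensor => exact zero_add _
  | tensor_comm => exact add_comm _ _

theorem Rel.cod_eq {N : PetriNet.{u}} {A B A' B' : Multiset N.Place} {f : Term N A B}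
    {g : Term N A' B'} (h : Rel f g) : B = B' := by
  induction h with
  | refl | comp_congr | id_comp | comp_id | assoc | tensor_id | interchange => first | rfl | assumption
  | symm _ ih => exact ih.symm
  | trans _ _ ih ih' => exact ih.trans ih'
  | tensor_congr _ _ ih ih' => rw [ih, ih']
  | tensor_assoc => exact add_assoc _ _ _
  | id_zero_tensor => exact zero_add _
  | tensor_comm => exact add_comm _ _

/-- The multiset of transitions used in a term, with multiplicities. -/
def count {N : PetriNet.{u}} : ∀ {A B : Multiset N.Place}, Term N A B → Multiset N.Transition
  | _, _, id _ => 0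
  | _, _, gen t => {t}
  | _, _, comp f g => f.count + g.count
  | _, _, tensor f g => f.count + g.count

theorem Rel.count_eq {N : PetriNet.{u}} {A B A' B' : Multiset N.Place} {f : Term N A B}
    {g : Term N A' B'} (h : Rel f g) : f.count = g.count := by
  induction h with
  | symm _ ih => exact ih.symm
  | trans _ _ ih ih' => exact ih.trans ih'
  | _ => simp_all [count, add_assoc, add_comm, add_left_comm]

/-- The setoid of terms with fixed domain and codomain. -/
instance setoid (N : PetriNet.{u}) (A B : Multiset N.Place) : Setoid (Term N A B) where
  r f g := Rel f g
  iseqv := ⟨Rel.refl, Rel.symm, Rel.trans⟩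

end Term

/-- The objects of the free commutative strict monoidal category on a net: its markings. -/
def Comm (N : PetriNet.{u}) : Type u := Multiset N.Place

namespace Comm

variable {N : PetriNet.{u}}

/-- The free commutative strict monoidal category generated by a net. -/
instance : Category.{u} (Comm N) where
  Hom A B := Quotient (Term.setoid N A B)
  id A := Quotient.mk _ (Term.id A)
  comp := Quotient.map₂ Term.comp fun _ _ h _ _ h' => Term.Rel.comp_congr h h'
  id_comp := by rintro A B ⟨f⟩; exact Quotient.sound (Term.Rel.id_comp f)
  comp_id := by rintro A B ⟨f⟩; exact Quotient.sound (Term.Rel.comp_id f)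
  assoc := by rintro A B C D ⟨f⟩ ⟨g⟩ ⟨h⟩; exact Quotient.sound (Term.Rel.assoc f g h)

theorem heq_of_rel {A B A' B' : Multiset N.Place} {f : Term N A B} {g : Term N A' B'}
    (h : Term.Rel f g) :
    HEq (Quotient.mk (Term.setoid N A B) f) (Quotient.mk (Term.setoid N A' B') g) := by
  obtain rfl := h.dom_eq
  obtain rfl := h.cod_eq
  exact heq_of_eq (Quotient.sound h)

instance : AddCommMonoid (Comm N) := inferInstanceAs (AddCommMonoid (Multiset N.Place))

instance : CommStrictMonoidalCategory (Comm N) where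
  tensorHom := fun {A A' B B'} => Quotient.map₂ (sa := Term.setoid N A A')
    (sb := Term.setoid N B B') (sc := Term.setoid N (A + B : Multiset N.Place) (A' + B'))
    Term.tensor fun _ _ h _ _ h' => Term.Rel.tensor_congr h h'
  tensorHom_id A B := Quotient.sound (Term.Rel.tensor_id A B)
  tensorHom_comp := by
    rintro A A' A'' B B' B'' ⟨f⟩ ⟨f'⟩ ⟨g⟩ ⟨g'⟩
    exact Quotient.sound (Term.Rel.interchange f f' g g')
  tensorHom_assoc := by
    rintro A A' B B' D D' ⟨f⟩ ⟨g⟩ ⟨h⟩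
    exact heq_of_rel (Term.Rel.tensor_assoc f g h)
  id_zero_tensorHom := by
    rintro A A' ⟨f⟩
    exact heq_of_rel (Term.Rel.id_zero_tensor f)
  tensorHom_comm := by
    rintro A A' B B' ⟨f⟩ ⟨g⟩
    exact heq_of_rel (Term.Rel.tensor_comm f g)

/-- The generator-count function `χ`: how many times each transition is used in a morphism. -/
def χ {A B : Comm N} (f : A ⟶ B) : Multiset N.Transition :=
  Quotient.lift Term.count (fun _ _ h => Term.Rel.count_eq h) f

theorem χ_id (A : Comm N) : χ (𝟙 A) = 0 := rfl

theorem χ_comp {A B C : Comm N} (f : A ⟶ B) (g : B ⟶ C) : χ (f ≫ g) = χ f + χ g := by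
  obtain ⟨f⟩ := f
  obtain ⟨g⟩ := g
  rfl

theorem χ_eqToHom {A B : Comm N} (h : A = B) : χ (eqToHom h) = 0 := by
  subst h
  rfl

theorem χ_tensor {A A' B B' : Comm N} (f : A ⟶ A') (g : B ⟶ B') :
    χ (f ⊕ₘ g) = χ f + χ g := by
  obtain ⟨f⟩ := f
  obtain ⟨g⟩ := g
  rfl

theorem χ_heq {A B A' B' : Comm N} (hA : A = A') (hB : B = B') {f : A ⟶ B} {g : A' ⟶ B'}
    (h : HEq f g) : χ f = χ g := by
  subst hA hB
  cases h
  rfl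

end Comm

/-! ## The external bound semantics -/

section ExternalBound

open SetSpan Comm

variable (N : PetriNet.{u})

/-- The set of markings, as an object of the bicategory of spans. -/
def boundObj : SpanObj.{u} := ⟨Multiset N.Place⟩

variable {N}

/-- The span `Markings ← χ⁻¹(χ f) → Markings` with legs the target and the source; here
`Arrow (Comm N)` is the set of all morphisms, with arbitrary domain (`left`) and codomain
(`right`). -/
def boundMap {A B : Comm N} (f : A ⟶ B) : N.boundObj ⟶ N.boundObj :=
  SetSpan.mk { x : Arrow (Comm N) // χ x.hom = χ f } (fun x => x.1.right) (fun x => x.1.left)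

/-- The comparison for identities sends a marking to its identity morphism. -/
def boundMapId (A : Comm N) : 𝟙 N.boundObj ⟶ boundMap (𝟙 A) :=
  Map.mk (fun (M : Comm N) => ⟨Arrow.mk (𝟙 M), rfl⟩) (fun _ => rfl) (fun _ => rfl)

/-- The comparison for composites composes two composable morphisms. -/
def boundMapComp {A B C : Comm N} (f : A ⟶ B) (g : B ⟶ C) :
    boundMap f ≫ boundMap g ⟶ boundMap (f ≫ g) :=
  Map.mk (fun p =>
      have hp : p.1.2.1.right = p.1.1.1.left := p.2.symm
      ⟨Arrow.mk (p.1.2.1.hom ≫ eqToHom hp ≫ p.1.1.1.hom), by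
        have h₁ : χ p.1.1.1.hom = χ f := p.1.1.2
        have h₂ : χ p.1.2.1.hom = χ g := p.1.2.2
        calc χ (p.1.2.1.hom ≫ eqToHom hp ≫ p.1.1.1.hom)
            = χ p.1.2.1.hom + (χ (eqToHom hp) + χ p.1.1.1.hom) := by rw [χ_comp, χ_comp]
          _ = χ g + (0 + χ f) := by rw [χ_eqToHom, h₁, h₂]
          _ = χ (f ≫ g) := by rw [χ_comp, zero_add, add_comm]⟩)
    (fun _ => rfl) (fun _ => rfl)

variable (N) in
/-- The laxator is the sum of markings. -/
def boundLaxator : N.boundObj ⊠ N.boundObj ⟶ N.boundObj :=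
  ofFun fun p : Multiset N.Place × Multiset N.Place => p.1 + p.2

/-- The components of the laxator at morphisms are given by the monoidal product of morphisms. -/
def boundLaxatorNat {A B D A' B' D' : Comm N} (h : A + B = D) (h' : A' + B' = D')
    (f : A ⟶ A') (g : B ⟶ B') (k : D ⟶ D') (hk : HEq k (f ⊕ₘ g)) :
    (boundMap f ⊠₁ boundMap g) ≫ N.boundLaxator ⟶ N.boundLaxator ≫ boundMap k :=
  Map.mk (fun p => ⟨((p.1.1.1.1.right, p.1.1.2.1.right),
      ⟨Arrow.mk (p.1.1.1.1.hom ⊕ₘ p.1.1.2.1.hom), by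
        change χ (p.1.1.1.1.hom ⊕ₘ p.1.1.2.1.hom) = χ k
        rw [χ_heq h.symm h'.symm hk, χ_tensor, χ_tensor, p.1.1.1.2, p.1.1.2.2]⟩), rfl⟩)
    (fun _ => rfl)
    (fun p => congrArg (fun q : Multiset N.Place × Multiset N.Place => q.1 + q.2) p.2)

variable (N) in
/-- The unit picks out the empty marking. -/
def boundUnit : unitObj ⟶ N.boundObj := ofFun fun _ => (0 : Multiset N.Place)

variable (N) in
/-- A lax-monoidal-lax functor is the external bound semantics of `N` if it has the prescribed
values on objects and morphisms, with comparison maps given by composition and monoidal product in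
`Comm N`. (The remaining structure is uniquely determined.) -/
structure IsExternalBound (F : LaxMonoidalLaxFunctor.{u} (Comm N)) : Prop where
  obj : ∀ A : Comm N, F.obj ⟨A⟩ = N.boundObj
  map : ∀ {A B : Comm N} (f : A ⟶ B), HEq (F.map f.toLoc) (boundMap f)
  mapId : ∀ A : Comm N, HEq (F.mapId ⟨A⟩) (boundMapId A)
  mapComp : ∀ {A B C : Comm N} (f : A ⟶ B) (g : B ⟶ C),
    HEq (F.mapComp f.toLoc g.toLoc) (boundMapComp f g)
  laxator : ∀ {A B D : Comm N} (h : A + B = D), HEq (F.laxator h) N.boundLaxator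
  laxatorNat : ∀ {A B D A' B' D' : Comm N} (h : A + B = D) (h' : A' + B' = D')
    (f : A ⟶ A') (g : B ⟶ B') (k : D ⟶ D') (hk : HEq k (f ⊕ₘ g)),
    HEq (F.laxatorNat h h' f g k hk) (boundLaxatorNat h h' f g k hk)
  unit : HEq F.unit N.boundUnit

end ExternalBound

end PetriNet

/-! ## Petri nets with a semantics in spans -/

/-- A Petri net with a commutative non-local semantics in spans. -/
structure PetriSpan : Type (u + 1) where
  net : PetriNet.{u}
  sem : LaxMonoidalLaxFunctor.{u} net.Comm

namespace PetriSpan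

/-- A morphism of Petri nets with semantics in spans: a strict monoidal functor between the
categories of executions over the semantics. -/
@[ext]
structure Hom (X Y : PetriSpan.{u}) : Type u where
  functor : StrictMonoidalFunctor X.net.Comm Y.net.Comm
  comm : TriangleCommutes X.sem functor Y.sem

/-- The identity morphism. -/
def Hom.id (X : PetriSpan.{u}) : Hom X X where
  functor := StrictMonoidalFunctor.id _
  comm :=
    { obj _ := rfl
      map _ := HEq.rfl
      mapId _ := HEq.rfl
      mapComp _ _ := HEq.rfl
      laxator _ _ := HEq.rfl
      laxatorNat _ _ _ _ _ _ _ _ _ := HEq.rfl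
      unit := HEq.rfl
      assocMod _ _ _ _ _ _ _ _ := HEq.rfl
      leftMod _ := HEq.rfl
      rightMod _ := HEq.rfl }

/-- The composite of two morphisms. -/
def Hom.comp {X Y Z : PetriSpan.{u}} (F : Hom X Y) (G : Hom Y Z) : Hom X Z where
  functor := F.functor.comp G.functor
  comm :=
    have key : ∀ {A B D : X.net.Comm}, A + B = D →
        F.functor.obj A + F.functor.obj B = F.functor.obj D :=
      fun h => (F.functor.obj_add _ _).symm.trans (congrArg _ h)
    { obj A := (F.comm.obj A).trans (G.comm.obj _)
      map f := (F.comm.map f).trans (G.comm.map _)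
      mapId A := (F.comm.mapId A).trans (G.comm.mapId _)
      mapComp f g := (F.comm.mapComp f g).trans (G.comm.mapComp _ _)
      laxator h i := (F.comm.laxator h (key h)).trans (G.comm.laxator (key h) i)
      laxatorNat h h' f g k hk i i' ik :=
        have hk' : HEq (F.functor.map k) (F.functor.map f ⊕ₘ F.functor.map g) :=
          (F.functor.map_heq h.symm h'.symm hk).trans
            (F.functor.map_tensorHom f g)
        (F.comm.laxatorNat h h' f g k hk (key h) (key h') hk').trans
          (G.comm.laxatorNat (key h) (key h') _ _ _ hk' i i' ik)
      unit := F.comm.unit.trans G.comm.unit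
      assocMod h₁₂ h₂₃ hl hr i₁₂ i₂₃ il ir :=
        (F.comm.assocMod h₁₂ h₂₃ hl hr (key h₁₂) (key h₂₃) (key hl) (key hr)).trans
          (G.comm.assocMod (key h₁₂) (key h₂₃) (key hl) (key hr) i₁₂ i₂₃ il ir)
      leftMod A := (F.comm.leftMod A).trans (G.comm.leftMod _)
      rightMod A := (F.comm.rightMod A).trans (G.comm.rightMod _) }

/-- The category of Petri nets with a commutative non-local semantics in spans. -/
instance : Category.{u} PetriSpan.{u} where
  Hom := Hom
  id := Hom.id
  comp := Hom.comp
  id_comp _ := rfl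
  comp_id _ := rfl
  assoc _ _ _ := rfl

end PetriSpan

/-- A subcategory: a class of objects and a class of morphisms between them that contains the
identities and is closed under composition. -/
structure Subcategory (C : Type u) [Category.{v} C] where
  obj : Set C
  hom : ∀ X Y : C, Set (X ⟶ Y)
  dom_mem : ∀ {X Y : C} {f : X ⟶ Y}, f ∈ hom X Y → X ∈ obj
  cod_mem : ∀ {X Y : C} {f : X ⟶ Y}, f ∈ hom X Y → Y ∈ obj
  id_mem : ∀ {X : C}, X ∈ obj → 𝟙 X ∈ hom X X
  comp_mem : ∀ {X Y Z : C} {f : X ⟶ Y} {g : Y ⟶ Z}, f ∈ hom X Y → g ∈ hom Y Z →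
    f ≫ g ∈ hom X Z

/-!
The external bound semantics is a lax-monoidal-lax functor because `Comm N` is a commutative strict
monoidal category and `χ` is additive both for composition and for the monoidal product.

On 2-cells, everything is a function between apexes. The laxator `⊕`, the unit, and the structural
1-cells of the tensor product are spans whose left leg is an identity. Composites and tensor
products of spans with injective left leg have injective left leg, and parallel maps into such a
span are equal (`SetSpan.eq_of_left_injective`); hence the coherence laws for fourfold products and
for the unit hold automatically. The naturality laws compare maps into a composite `m ≫ boundMap f`
in which `m` has injective left leg, so that only the components in the apex of `boundMap f` have
to be compared (`SetSpan.hom_ext_of_left_injective`). These components are morphisms of `Comm N`,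
and the equations between them are laws of a commutative strict monoidal category: functoriality of
`⊕ₘ` for the laxator, associativity and unit laws of `⊕ₘ` for the modifications. The laws of the
underlying lax functor are the associativity and unit laws of composition.

The pairs of a net and its semantics are then the objects of a full subcategory.
-/

/-! ### Spans with injective left leg -/

namespace SetSpan

/-- A map of spans commutes with the left legs, so it is determined by its source and target when
the left leg of the target is injective. -/
theorem eq_of_left_injective {X Y : SpanObj.{u}} {f g : X ⟶ Y} (hg : Function.Injective g.left)
    (a b : f ⟶ g) : a = b :=
  SetSpan.hom_ext fun x => hg ((Map.left_fn a x).trans (Map.left_fn b x).symm)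

theorem comp_left_injective {X Y Z : SpanObj.{u}} {f : X ⟶ Y} {g : Y ⟶ Z}
    (hf : Function.Injective f.left) (hg : Function.Injective g.left) :
    Function.Injective (f ≫ g).left := by
  rintro ⟨⟨a, b⟩, h⟩ ⟨⟨a', b'⟩, h'⟩ e
  obtain rfl : a = a' := hf e
  obtain rfl : b = b' := hg (h.symm.trans h')
  rfl

theorem tensor_left_injective {X Y X' Y' : SpanObj.{u}} {f : X ⟶ Y} {g : X' ⟶ Y'}
    (hf : Function.Injective f.left) (hg : Function.Injective g.left) :
    Function.Injective (f ⊠₁ g).left := fun _ _ e =>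
  Prod.ext (hf (congrArg Prod.fst e)) (hg (congrArg Prod.snd e))

theorem ofFun_left_injective {X Y : SpanObj.{u}} (φ : X.carrier → Y.carrier) :
    Function.Injective (ofFun φ).left := Function.injective_id

theorem id_left_injective (X : SpanObj.{u}) :
    Function.Injective (SetSpan.left (𝟙 X : X ⟶ X)) := Function.injective_id

/-- A map into `m ≫ f` is determined by its component in the apex of `f` when the left leg of `m`
is injective. -/
theorem hom_ext_of_left_injective {X Y Z : SpanObj.{u}} {e : X ⟶ Z} {m : X ⟶ Y} {f : Y ⟶ Z}
    (hm : Function.Injective m.left) {a b : e ⟶ m ≫ f}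
    (h : ∀ x, (Map.fn a x).1.2 = (Map.fn b x).1.2) : a = b :=
  SetSpan.hom_ext fun x => Subtype.ext (Prod.ext
    (hm ((Map.left_fn a x).trans (Map.left_fn b x).symm)) (h x))

end SetSpan

/-! ### The underlying lax functor -/

namespace PetriNet

open SetSpan Comm

variable {N : PetriNet.{u}}

theorem Comm.arrow_ext {A B A' B' : Comm N} (hA : A = A') (hB : B = B') {f : A ⟶ B} {g : A' ⟶ B'}
    (h : HEq f g) : Arrow.mk f = Arrow.mk g := by
  subst hA hB
  cases h
  rfl

/-- The action on 2-cells. The 2-cells of the locally discrete bicategory `Comm N` are equalities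
`f = g`, along which the condition `χ h = χ f` on the elements `h` of the apex is transported. -/
def boundMap₂ {A B : Comm N} {f g : A ⟶ B} (h : f = g) : boundMap f ⟶ boundMap g :=
  Map.mk (fun x => ⟨x.1, x.2.trans (congrArg χ h)⟩) (fun _ => rfl) (fun _ => rfl)

variable (N) in
/-- The lax functor underlying the external bound semantics. -/
def boundLax : LaxFunctor (LocallyDiscrete N.Comm) SpanObj.{u} where
  obj _ := N.boundObj
  map f := boundMap f.as
  map₂ η := boundMap₂ (congrArg Discrete.as (LocallyDiscrete.eq_of_hom η))
  mapId A := boundMapId A.as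
  mapComp f g := boundMapComp f.as g.as
  map₂_id _ := rfl
  map₂_comp _ _ := rfl
  mapComp_naturality_left _ _ := rfl
  mapComp_naturality_right _ _ _ _ := rfl
  map₂_associator f g h := SetSpan.hom_ext fun p => by
    obtain ⟨⟨⟨⟨⟨⟨A, B, a⟩, ha⟩, ⟨⟨A', B', b⟩, hb⟩⟩, hab⟩, ⟨⟨A'', B'', c⟩, hc⟩⟩, hbc⟩ := p
    -- The pullback conditions identify endpoints, which turns the `eqToHom`s into identities.
    obtain rfl : A = B' := hab
    obtain rfl : A' = B'' := hbc
    refine Subtype.ext (congrArg (Arrow.mk (X := A'') (Y := B)) ?_)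
    change c ≫ 𝟙 _ ≫ b ≫ 𝟙 _ ≫ a = (c ≫ 𝟙 _ ≫ b) ≫ 𝟙 _ ≫ a
    simp only [Category.id_comp, Category.assoc]
  map₂_leftUnitor f := SetSpan.hom_ext fun p => by
    obtain ⟨⟨A, B, a⟩, ha⟩ := p
    refine Subtype.ext (congrArg (Arrow.mk (X := A) (Y := B)) ?_)
    change a = a ≫ 𝟙 _ ≫ 𝟙 _
    simp only [Category.comp_id]
  map₂_rightUnitor f := SetSpan.hom_ext fun p => by
    obtain ⟨⟨A, B, a⟩, ha⟩ := p
    refine Subtype.ext (congrArg (Arrow.mk (X := A) (Y := B)) ?_)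
    change a = 𝟙 _ ≫ 𝟙 _ ≫ a
    simp only [Category.id_comp]

/-! ### The monoidal structure -/

variable (N) in
/-- The associativity modification: both sides are the span of the function
`((x, y), z) ↦ x + y + z`. -/
def boundAssocMod : (N.boundLaxator ⊠₁ 𝟙 N.boundObj) ≫ N.boundLaxator ≅
    assoc N.boundObj N.boundObj N.boundObj ≫ (𝟙 N.boundObj ⊠₁ N.boundLaxator) ≫ N.boundLaxator :=
  mkIso
    { toFun := fun p => ⟨(p.1.1, ⟨((p.1.1.1.1, (p.1.1.1.2, p.1.1.2)),
        (p.1.1.1.1, N.boundLaxator.right (p.1.1.1.2, p.1.1.2))), rfl⟩), rfl⟩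
      invFun := fun p => ⟨(p.1.1, (N.boundLaxator.right p.1.1.1, p.1.1.2)), rfl⟩
      left_inv := fun _ => comp_left_injective
        (tensor_left_injective (ofFun_left_injective _) (id_left_injective _))
        (ofFun_left_injective _) rfl
      right_inv := fun _ => comp_left_injective (ofFun_left_injective _) (comp_left_injective
        (tensor_left_injective (id_left_injective _) (ofFun_left_injective _))
        (ofFun_left_injective _)) rfl }
    (fun _ => rfl)
    (fun p => (add_assoc (G := Multiset N.Place) _ _ _).symm.trans
      (congrArg N.boundLaxator.right p.2))

variable (N) in
/-- The left unit modification: both sides are the span of the function `(*, x) ↦ x`. -/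
def boundLeftMod : (N.boundUnit ⊠₁ 𝟙 N.boundObj) ≫ N.boundLaxator ≅ leftUnit N.boundObj :=
  mkIso
    { toFun := fun p => p.1.1
      invFun := fun q => ⟨(q, ((0 : Multiset N.Place), q.2)), rfl⟩
      left_inv := fun _ => comp_left_injective
        (tensor_left_injective (ofFun_left_injective _) (id_left_injective _))
        (ofFun_left_injective _) rfl
      right_inv := fun _ => rfl }
    (fun _ => rfl)
    (fun p => (zero_add (M := Multiset N.Place) _).symm.trans
      (congrArg N.boundLaxator.right p.2))

variable (N) in
/-- The right unit modification: both sides are the span of the function `(x, *) ↦ x`. -/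
def boundRightMod : (𝟙 N.boundObj ⊠₁ N.boundUnit) ≫ N.boundLaxator ≅ rightUnit N.boundObj :=
  mkIso
    { toFun := fun p => p.1.1
      invFun := fun q => ⟨(q, (q.1, (0 : Multiset N.Place))), rfl⟩
      left_inv := fun _ => comp_left_injective
        (tensor_left_injective (id_left_injective _) (ofFun_left_injective _))
        (ofFun_left_injective _) rfl
      right_inv := fun _ => rfl }
    (fun _ => rfl)
    (fun p => (add_zero (M := Multiset N.Place) _).symm.trans
      (congrArg N.boundLaxator.right p.2))

theorem Comm.tensorHom_zero {A A' : Comm N} (f : A ⟶ A') : HEq (f ⊕ₘ 𝟙 (0 : Comm N)) f :=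
  (CommStrictMonoidalCategory.tensorHom_comm f _).trans
    (CommStrictMonoidalCategory.id_zero_tensorHom f)

variable (N) in
/-- The external bound semantics of a Petri net. -/
def externalBound : LaxMonoidalLaxFunctor.{u} N.Comm where
  toLaxFunctor := boundLax N
  laxator _ := N.boundLaxator
  laxatorNat h h' f g k hk := boundLaxatorNat h h' f g k hk
  laxatorNat_id _ _ := hom_ext_of_left_injective (ofFun_left_injective _) fun p => by
    obtain ⟨⟨⟨M, M'⟩, m⟩, hm⟩ := p
    obtain rfl : (M, M') = m := hm
    exact Subtype.ext (congrArg (Arrow.mk (X := _) (Y := _))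
      (CommStrictMonoidalCategory.tensorHom_id (C := Comm N) M M'))
  laxatorNat_comp _ _ _ _ _ _ _ _ _ _ _ _ :=
    hom_ext_of_left_injective (ofFun_left_injective _) fun p => by
      obtain ⟨⟨⟨⟨⟨⟨⟨A, B, a⟩, ha⟩, ⟨⟨A', B', b⟩, hb⟩⟩, ⟨⟨⟨C, D, c⟩, hc⟩, ⟨⟨C', D', d⟩, hd⟩⟩⟩,
        hcd⟩, m⟩, hm⟩ := p
      obtain rfl : A = D := congrArg Prod.fst hcd
      obtain rfl : A' = D' := congrArg Prod.snd hcd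
      refine Subtype.ext (congrArg (Arrow.mk (X := C + C') (Y := B + B')) ?_)
      change (c ≫ 𝟙 _ ≫ a) ⊕ₘ (d ≫ 𝟙 _ ≫ b) = (c ⊕ₘ d) ≫ 𝟙 _ ≫ (a ⊕ₘ b)
      simp only [Category.id_comp, CommStrictMonoidalCategory.tensorHom_comp]
  unit := N.boundUnit
  assocMod _ _ _ _ := boundAssocMod N
  leftMod _ := boundLeftMod N
  rightMod _ := boundRightMod N
  assocMod_naturality _ _ _ _ _ _ _ _ _ _ _ _ _ _ _ _ _ _ :=
    -- The coherence isomorphisms inserted by `⊗≫` only rearrange tuples, so by definitional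
    -- unfolding the two sides send `((h₁, h₂), h₃)` to `(h₁ ⊕ₘ h₂) ⊕ₘ h₃` and `h₁ ⊕ₘ (h₂ ⊕ₘ h₃)`.
    hom_ext_of_left_injective (comp_left_injective (ofFun_left_injective _) (comp_left_injective
      (tensor_left_injective (id_left_injective _) (ofFun_left_injective _))
      (ofFun_left_injective _))) fun p =>
      Subtype.ext (Comm.arrow_ext (add_assoc _ _ _) (add_assoc _ _ _)
        (CommStrictMonoidalCategory.tensorHom_assoc p.1.1.1.1.1.hom p.1.1.1.2.1.hom p.1.1.2.1.hom))
  leftMod_naturality _ _ :=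
    -- The component of `laxatorNat` at `𝟙 0` and `f` meets the morphism `𝟙 0` provided by `mapId`:
    -- the two sides send `h` to `𝟙 0 ⊕ₘ h` and `h`.
    hom_ext_of_left_injective (ofFun_left_injective _) fun p =>
      Subtype.ext (Comm.arrow_ext (zero_add _) (zero_add _)
        (CommStrictMonoidalCategory.id_zero_tensorHom p.1.1.2.1.hom))
  rightMod_naturality _ _ :=
    hom_ext_of_left_injective (ofFun_left_injective _) fun p =>
      Subtype.ext (Comm.arrow_ext (add_zero _) (add_zero _)
        (Comm.tensorHom_zero p.1.1.1.1.hom))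
  assocMod_coherence _ _ _ _ _ _ _ _ _ _ := eq_of_left_injective
    (comp_left_injective
      (comp_left_injective (ofFun_left_injective _) (ofFun_left_injective _))
      (comp_left_injective
        (tensor_left_injective (id_left_injective _)
          (tensor_left_injective (id_left_injective _) (ofFun_left_injective _)))
        (comp_left_injective (tensor_left_injective (id_left_injective _) (ofFun_left_injective _))
          (ofFun_left_injective _)))) _ _
  unit_coherence _ := eq_of_left_injective
    (comp_left_injective (tensor_left_injective (ofFun_left_injective _) (id_left_injective _))
      (ofFun_left_injective _)) _ _

theorem isExternalBound_externalBound : N.IsExternalBound (externalBound N) where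
  obj _ := rfl
  map _ := HEq.rfl
  mapId _ := HEq.rfl
  mapComp _ _ := HEq.rfl
  laxator _ := HEq.rfl
  laxatorNat _ _ _ _ _ _ := HEq.rfl
  unit := HEq.rfl

end PetriNet

/-! ### The full subcategory of external bound semantics -/

/-- The full subcategory on a class of objects. -/
def Subcategory.full {C : Type u} [Category.{v} C] (P : Set C) : Subcategory C where
  obj := P
  hom X Y := {_f | X ∈ P ∧ Y ∈ P}
  dom_mem h := h.1
  cod_mem h := h.2
  id_mem h := ⟨h, h⟩
  comp_mem h h' := ⟨h.1, h'.2⟩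

theorem Subcategory.full_hom {C : Type u} [Category.{v} C] {P : Set C} {X Y : C} (hX : X ∈ P)
    (hY : Y ∈ P) : (Subcategory.full P).hom X Y = Set.univ :=
  Set.eq_univ_of_forall fun _ => ⟨hX, hY⟩

theorem mainTheorem2 :
    ∃ sharp : ∀ N : PetriNet.{u}, LaxMonoidalLaxFunctor.{u} N.Comm,
      (∀ N : PetriNet.{u}, N.IsExternalBound (sharp N)) ∧
      ∃ PetriCommBound : Subcategory PetriSpan.{u},
        PetriCommBound.obj = {X | ∃ N : PetriNet.{u}, X = ⟨N, sharp N⟩} ∧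
        ∀ X Y : PetriSpan.{u}, X ∈ PetriCommBound.obj → Y ∈ PetriCommBound.obj →
          PetriCommBound.hom X Y = Set.univ :=
  ⟨PetriNet.externalBound, fun _ => PetriNet.isExternalBound_externalBound,
    Subcategory.full _, rfl, fun _ _ => Subcategory.full_hom⟩
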